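/- Let $A$ be a commutative Noetherian $\mathbb{C}$-algebra that is a domain, and let $\delta$ be a non-zero $\mathbb{C}$-linear derivation of $A$. Let $R=A[z;\delta]$ be the Ore extension, that is, the $\mathbb{C}$-algebra of formal sums $\sum_i a_iz^i$ ($a_i\in A$) with multiplication determined by $za=az+\delta(a)$ for $a\in A$. Let $B=A[z]$ be the commutative polynomial algebra with the Poisson bracket such that $\{A,A\}=0$ and $\{z,a\}=\delta(a)$ for $a\in A$. An ideal $I$ of $B$ is *Poisson* if $\{b,i\}\in I$ for all $b\in B$, $i\in I$; a proper Poisson ideal $P$ is *Poisson prime* if, for all Poisson ideals $I,I'$ of $B$, $II'\subseteq P$ implies $I\subseteq P$ or $I'\subseteq P$; it is *residually null* if $\{B,B\}\subseteq P$. A $\delta$-*ideal* of $A$ is an ideal $I$ with $\delta(I)\subseteq I$, and $\delta$-*prime* ideals of $A$ are defined in the same way with $\delta$-ideals in place of Poisson ideals. Let $\operatorname{P.spec}B$ be the set of Poisson prime ideals of $B$, with closed sets $\{P: I\subseteq P\}$ for $I$ an ideal of $B$. Let $\operatorname{spec}R$ be the set of prime ideals of $R$ (proper two-sided ideals $P$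 such that, for all two-sided ideals $I,I'$ of $R$, $II'\subseteq P$ implies $I\subseteq P$ or $I'\subseteq P$), with closed sets $\{P: I\subseteq P\}$ for $I$ a two-sided ideal of $R$. Let $J=\delta(A)A$. For every $\delta$-ideal $Q$ of $A$ (in particular for $Q=J$) the right ideal $QR$ of $R$ is two-sided. Then there is a homeomorphism $\Gamma:\operatorname{P.spec}B\to\operatorname{spec}R$ such that: 1. for $P\in\operatorname{P.spec}B$, $P$ is residually null if and only if $R/\Gamma(P)$ is commutative; 2. there is an isomorphism of $\mathbb{C}$-algebras $\kappa:B/JB\to R/JR$ with $\kappa\left(\sum_i a_iz^i+JB\right)=\sum_i a_iz^i+JR$, and $\Gamma(P)/JR=\kappa(P/JB)$ for every residually null $P\in\operatorname{P.spec}B$; 3. every $P\in\operatorname{P.spec}B$ that is not residually null has the form $P=QB$ with $Q$ a $\delta$-prime ideal of $A$ such that $J\not\subseteq Q$, and $\Gamma(P)=QR$. -/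

import Mathlib

open Polynomial

/-! ## Prime ideals relative to a set of derivations -/

section DerivationPrimes

variable {k S : Type*} [CommRing k] [CommRing S] [Algebra k S]

/-- An ideal `I` is a `Δ`-ideal if `d I ⊆ I` for every `d` in `Δ`. -/
def IsDerivIdeal (Δ : Set (Derivation k S S)) (I : Ideal S) : Prop :=
  ∀ d ∈ Δ, ∀ x ∈ I, d x ∈ I

/-- `P` is `Δ`-prime: a proper `Δ`-ideal such that, for all `Δ`-ideals `I` and `J`,
`I J ⊆ P` implies `I ⊆ P` or `J ⊆ P`. -/
structure IsDerivPrime (Δ : Set (Derivation k S S)) (P : Ideal S) : Prop where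
  isDerivIdeal : IsDerivIdeal Δ P
  ne_top : P ≠ ⊤
  le_or_le : ∀ I J : Ideal S, IsDerivIdeal Δ I → IsDerivIdeal Δ J → I * J ≤ P → I ≤ P ∨ J ≤ P

/-- The set of `Δ`-prime ideals of `S`. -/
@[ext]
structure DerivPrimeSpectrum (Δ : Set (Derivation k S S)) where
  asIdeal : Ideal S
  isDerivPrime : IsDerivPrime Δ asIdeal

/-- `V(I)`, the set of `Δ`-primes that contain `I`. -/
def DerivPrimeSpectrum.zeroLocus (Δ : Set (Derivation k S S)) (I : Ideal S) :
    Set (DerivPrimeSpectrum Δ) :=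
  {P | I ≤ P.asIdeal}

/-- The `Δ`-ideal generated by `I` has the same zero locus as `I`. -/
theorem DerivPrimeSpectrum.exists_zeroLocus_eq (Δ : Set (Derivation k S S)) (I : Ideal S) :
    ∃ I' : Ideal S, IsDerivIdeal Δ I' ∧ zeroLocus Δ I' = zeroLocus Δ I := by
  refine ⟨sInf {K | IsDerivIdeal Δ K ∧ I ≤ K}, ?_, ?_⟩
  · intro d hd x hx
    rw [Submodule.mem_sInf] at hx ⊢
    exact fun K hK => hK.1 d hd x (hx K hK)
  · ext P
    change sInf {K | IsDerivIdeal Δ K ∧ I ≤ K} ≤ P.asIdeal ↔ I ≤ P.asIdeal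
    constructor
    · exact le_trans (le_sInf fun K hK => hK.2)
    · exact fun h => sInf_le ⟨P.isDerivPrime.isDerivIdeal, h⟩

/-- The Zariski topology: the closed sets are the sets `V(I)`, `I` an ideal of `S`. -/
instance (Δ : Set (Derivation k S S)) : TopologicalSpace (DerivPrimeSpectrum Δ) :=
  TopologicalSpace.ofClosed {Z | ∃ I : Ideal S, Z = DerivPrimeSpectrum.zeroLocus Δ I}
    ⟨⊤, by
      ext P
      simpa [DerivPrimeSpectrum.zeroLocus] using P.isDerivPrime.ne_top⟩
    (by
      intro T hT
      refine ⟨sSup {I | DerivPrimeSpectrum.zeroLocus Δ I ∈ T}, ?_⟩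
      ext P
      simp only [Set.mem_sInter, DerivPrimeSpectrum.zeroLocus, Set.mem_ofPred_eq, sSup_le_iff]
      constructor
      · intro h I hI
        exact h _ hI
      · intro h Z hZ
        obtain ⟨I, rfl⟩ := hT hZ
        exact h I hZ)
    (by
      rintro _ ⟨I, rfl⟩ _ ⟨J, rfl⟩
      obtain ⟨I', hI', hI⟩ := DerivPrimeSpectrum.exists_zeroLocus_eq Δ I
      obtain ⟨J', hJ', hJ⟩ := DerivPrimeSpectrum.exists_zeroLocus_eq Δ J
      refine ⟨I' ⊓ J', ?_⟩
      rw [← hI, ← hJ]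
      ext P
      constructor
      · rintro (h | h)
        · exact le_trans (inf_le_left : _ ⊓ _ ≤ _) (show _ ≤ P.asIdeal from h)
        · exact le_trans (inf_le_right : _ ⊓ _ ≤ _) (show _ ≤ P.asIdeal from h)
      · intro h
        exact P.isDerivPrime.le_or_le I' J' hI' hJ' (le_trans Ideal.mul_le_inf h))

end DerivationPrimes

/-! ## Poisson algebras -/

/-- A Poisson bracket on a commutative `k`-algebra `S`, given by its hamiltonians
`ham a = {a, -}`, which are `k`-derivations depending `k`-linearly on `a`; together with `k`-linearity
the last two fields say that `S` is a Lie algebra under `{-,-}`. -/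
structure PoissonBracket (k S : Type*) [CommRing k] [CommRing S] [Algebra k S] where
  ham : S →ₗ[k] Derivation k S S
  ham_self : ∀ a, ham a a = 0
  jacobi : ∀ a b c, ham a (ham b c) + ham b (ham c a) + ham c (ham a b) = 0

namespace PoissonBracket

variable {k S : Type*} [CommRing k] [CommRing S] [Algebra k S]

/-- The Poisson prime spectrum: the `Δ`-prime spectrum for `Δ` the set of all hamiltonians. -/
abbrev PrimeSpectrum (π : PoissonBracket k S) : Type _ :=
  DerivPrimeSpectrum (Set.range π.ham)

/-- An ideal is residually null if it contains every bracket `{a, b}`; for a Poisson ideal `I` this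
says that the bracket induced on `S ⧸ I` is zero. -/
def ResiduallyNull (π : PoissonBracket k S) (I : Ideal S) : Prop :=
  ∀ a b, π.ham a b ∈ I

end PoissonBracket

/-! ## The prime spectrum of a ring that need not be commutative -/

/-- The set of prime ideals of `R`: proper two-sided ideals `P` such that, for all two-sided ideals
`I` and `J`, `I J ⊆ P` implies `I ⊆ P` or `J ⊆ P`. -/
@[ext]
structure TwoSidedPrimeSpectrum (R : Type*) [Ring R] where
  asIdeal : Ideal R
  isTwoSided : asIdeal.IsTwoSided
  ne_top : asIdeal ≠ ⊤
  le_or_le : ∀ I J : Ideal R, I.IsTwoSided → J.IsTwoSided →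
    I * J ≤ asIdeal → I ≤ asIdeal ∨ J ≤ asIdeal

namespace TwoSidedPrimeSpectrum

variable {R : Type*} [Ring R]

attribute [instance] TwoSidedPrimeSpectrum.isTwoSided

/-- `V(I)`, the set of primes that contain `I`. -/
def zeroLocus (I : Ideal R) : Set (TwoSidedPrimeSpectrum R) := {P | I ≤ P.asIdeal}

/-- The Zariski topology: the closed sets are the sets `V(I)`, `I` a two-sided ideal of `R`. -/
instance : TopologicalSpace (TwoSidedPrimeSpectrum R) :=
  TopologicalSpace.ofClosed {Z | ∃ I : Ideal R, I.IsTwoSided ∧ Z = zeroLocus I}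
    ⟨⊤, inferInstance, by
      ext P
      simpa [zeroLocus] using P.ne_top⟩
    (by
      intro T hT
      refine ⟨sSup {I : Ideal R | I.IsTwoSided ∧ zeroLocus I ∈ T}, ⟨?_⟩, ?_⟩
      · intro a b ha
        have key : sSup {I : Ideal R | I.IsTwoSided ∧ zeroLocus I ∈ T} ≤ Submodule.comap
            (LinearMap.toSpanSingleton R R b) (sSup {I | Ideal.IsTwoSided I ∧ zeroLocus I ∈ T}) := by
          refine sSup_le fun I hI x hx => ?_
          have := hI.1
          exact (le_sSup hI : I ≤ _) (I.mul_mem_right b hx)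
        exact key ha
      · ext P
        simp only [Set.mem_sInter, zeroLocus, Set.mem_ofPred_eq, sSup_le_iff]
        constructor
        · rintro h I ⟨_, hI⟩
          exact h _ hI
        · intro h Z hZ
          obtain ⟨I, hI, rfl⟩ := hT hZ
          exact h I ⟨hI, hZ⟩)
    (by
      rintro _ ⟨I, hI, rfl⟩ _ ⟨J, hJ, rfl⟩
      refine ⟨I ⊓ J, ⟨fun b h => ⟨I.mul_mem_right b h.1, J.mul_mem_right b h.2⟩⟩, ?_⟩
      ext P
      constructor
      · rintro (h | h)
        · exact le_trans (inf_le_left : _ ⊓ _ ≤ _) (show _ ≤ P.asIdeal from h)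
        · exact le_trans (inf_le_right : _ ⊓ _ ≤ _) (show _ ≤ P.asIdeal from h)
      · intro h
        refine P.le_or_le I J hI hJ (le_trans ?_ h)
        rw [Ideal.mul_le]
        exact fun r hr s hs => ⟨I.mul_mem_right s hr, J.mul_mem_left r hs⟩)

end TwoSidedPrimeSpectrum

/-! ## The two algebras attached to a derivation -/

section Ore

variable {k A : Type*} [CommRing k] [CommRing A] [Algebra k A]

/-- The ideal `δ(A)A`. -/
def derivRangeIdeal (δ : Derivation k A A) : Ideal A := Ideal.span (Set.range δ)

theorem isDerivIdeal_derivRangeIdeal (δ : Derivation k A A) :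
    IsDerivIdeal {δ} (derivRangeIdeal δ) := by
  rintro d rfl x -
  exact Ideal.subset_span ⟨x, rfl⟩

/-- `δ` acting on the coefficients of a polynomial, as a linear map. -/
noncomputable def coeffwise (δ : Derivation k A A) : A[X] →ₗ[k] A[X] :=
  Polynomial.lsum fun i => ((Polynomial.monomial i).restrictScalars k) ∘ₗ (δ : A →ₗ[k] A)

@[simp]
theorem coeffwise_monomial (δ : Derivation k A A) (n : ℕ) (a : A) :
    coeffwise δ (monomial n a) = monomial n (δ a) := by
  simp [coeffwise, Polynomial.sum_monomial_index]

theorem coeffwise_mul (δ : Derivation k A A) (p q : A[X]) :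
    coeffwise δ (p * q) = p • coeffwise δ q + q • coeffwise δ p := by
  induction p using Polynomial.induction_on' with
  | add p₁ p₂ h₁ h₂ => rw [add_mul, map_add, h₁, h₂, map_add, add_smul, smul_add]; abel
  | monomial n a =>
    induction q using Polynomial.induction_on' with
    | add q₁ q₂ h₁ h₂ => rw [mul_add, map_add, h₁, h₂, map_add, add_smul, smul_add]; abel
    | monomial m b =>
      simp only [monomial_mul_monomial, coeffwise_monomial, Derivation.leibniz, smul_eq_mul,
        map_add, add_comm m n]

/-- `δ` acting on the coefficients of a polynomial, as a derivation of `A[X]`. -/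
noncomputable def coeffDerivation (δ : Derivation k A A) : Derivation k A[X] A[X] :=
  Derivation.mk' (coeffwise δ) (coeffwise_mul δ)

@[simp]
theorem coeffDerivation_monomial (δ : Derivation k A A) (n : ℕ) (a : A) :
    coeffDerivation δ (monomial n a) = monomial n (δ a) :=
  coeffwise_monomial δ n a

theorem coeffDerivation_derivative (δ : Derivation k A A) (p : A[X]) :
    coeffDerivation δ (derivative p) = derivative (coeffDerivation δ p) := by
  induction p using Polynomial.induction_on' with
  | add p q hp hq => simp only [map_add, hp, hq]
  | monomial n a => simp [derivative_monomial, mul_comm]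

/-- The Poisson bracket on `A[z]` with `{A, A} = 0` and `{z, a} = δ a`, namely
`{p, q} = (∂p/∂z) δ(q) - δ(p) (∂q/∂z)` with `δ` acting on coefficients. -/
noncomputable def polyPoisson (δ : Derivation k A A) : PoissonBracket k A[X] where
  ham :=
    { toFun := fun p => derivative p • coeffDerivation δ -
        coeffDerivation δ p • (Polynomial.derivative' : Derivation A A[X] A[X]).restrictScalars k
      map_add' := fun p q => by
        ext1 r
        simp only [map_add, add_smul, Derivation.add_apply, Derivation.sub_apply]
        abel
      map_smul' := fun c p => by
        ext1 r
        simp [smul_sub] }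
  ham_self := fun p => by
    simp [mul_comm]
  jacobi := fun p q r => by
    simp [coeffDerivation_derivative]
    ring

theorem polyPoisson_monomial (δ : Derivation k A A) (m n : ℕ) (a b : A) :
    (polyPoisson δ).ham (monomial m a) (monomial n b) =
      monomial (m + n - 1) (m * a * δ b - n * b * δ a) := by
  simp only [polyPoisson, LinearMap.coe_mk, AddHom.coe_mk, Derivation.sub_apply,
    Derivation.smul_apply, Derivation.restrictScalars_apply, coeffDerivation_monomial,
    Polynomial.derivative'_apply, derivative_monomial, smul_eq_mul, monomial_mul_monomial, map_sub]
  rcases m with _ | m <;> rcases n with _ | n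
  · simp
  · simp [mul_comm]
  · simp [mul_comm]
  · rw [show m + 1 - 1 + (n + 1) = m + 1 + (n + 1) - 1 by omega,
      show m + 1 + (n + 1 - 1) = m + 1 + (n + 1) - 1 by omega]
    congr 2 <;> ring

/-- The Ore extension `A[z;δ]`. Its elements are the formal sums `∑ aᵢ zⁱ`, stored as polynomials,
and its multiplication, defined below, satisfies `z a = a z + δ a`. -/
@[ext]
structure OreExtension (δ : Derivation k A A) where
  toPoly : A[X]

namespace OreExtension

variable (δ : Derivation k A A)

/-- The underlying set is that of `A[X]`. -/
@[simps]
def equivPoly : OreExtension δ ≃ A[X] where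
  toFun := toPoly
  invFun := mk
  left_inv _ := rfl
  right_inv _ := rfl

/-- Left multiplication by `z` on `A[z;δ]`: `∑ aᵢ zⁱ ↦ ∑ (aᵢ zⁱ⁺¹ + δ(aᵢ) zⁱ)`. -/
noncomputable def mulZ : Module.End k A[X] :=
  LinearMap.mulLeft k (Polynomial.X : A[X]) + coeffwise δ

/-- Left multiplication by `∑ aᵢ zⁱ`, that is `∑ aᵢ (mulZ)ⁱ`. -/
noncomputable def leftMul : A[X] →ₗ[A] Module.End k A[X] :=
  Polynomial.lsum fun i => LinearMap.toSpanSingleton A (Module.End k A[X]) (mulZ δ ^ i)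

theorem leftMul_monomial (n : ℕ) (a : A) : leftMul δ (monomial n a) = a • mulZ δ ^ n := by
  simp [leftMul, Polynomial.sum_monomial_index]

theorem mulZ_monomial (n : ℕ) (a : A) :
    mulZ δ (monomial n a) = monomial (n + 1) a + monomial n (δ a) := by
  simp [mulZ, X_mul_monomial]

theorem mulZ_smul (a : A) (p : A[X]) : mulZ δ (a • p) = a • mulZ δ p + δ a • p := by
  induction p using Polynomial.induction_on' with
  | add p q hp hq => simp only [smul_add, map_add, hp, hq]; abel
  | monomial n b =>
    simp only [smul_monomial, mulZ_monomial, smul_add, smul_eq_mul, Derivation.leibniz, map_add,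
      mul_comm b (δ a)]
    abel

theorem leftMul_mulZ (q : A[X]) : leftMul δ (mulZ δ q) = mulZ δ * leftMul δ q := by
  induction q using Polynomial.induction_on' with
  | add p q hp hq => simp only [map_add, hp, hq, mul_add]
  | monomial n b =>
    ext1 r
    simp [mulZ_monomial, leftMul_monomial, mulZ_smul, pow_succ']

theorem leftMul_mulZ_pow (n : ℕ) (q : A[X]) :
    leftMul δ ((mulZ δ ^ n) q) = mulZ δ ^ n * leftMul δ q := by
  induction n with
  | zero => simp
  | succ n ih => rw [pow_succ', Module.End.mul_apply, leftMul_mulZ, ih, mul_assoc]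

theorem leftMul_leftMul (p q : A[X]) : leftMul δ (leftMul δ p q) = leftMul δ p * leftMul δ q := by
  induction p using Polynomial.induction_on' with
  | add p₁ p₂ h₁ h₂ => simp only [map_add, LinearMap.add_apply, h₁, h₂, add_mul]
  | monomial n a =>
    rw [leftMul_monomial, LinearMap.smul_apply, map_smul, leftMul_mulZ_pow]
    rfl

theorem leftMul_one : leftMul δ 1 = 1 := by
  rw [← monomial_zero_one, leftMul_monomial]; simp

theorem mulZ_pow_one (n : ℕ) : (mulZ δ ^ n) (1 : A[X]) = monomial n 1 := by
  induction n with
  | zero => simp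
  | succ n ih => rw [pow_succ', Module.End.mul_apply, ih, mulZ_monomial]; simp

theorem leftMul_apply_one (p : A[X]) : leftMul δ p 1 = p := by
  induction p using Polynomial.induction_on' with
  | add p₁ p₂ h₁ h₂ => simp only [map_add, LinearMap.add_apply, h₁, h₂]
  | monomial n a =>
    rw [leftMul_monomial, LinearMap.smul_apply, mulZ_pow_one, smul_monomial, smul_eq_mul, mul_one]

noncomputable instance : AddCommGroup (OreExtension δ) := (equivPoly δ).addCommGroup

noncomputable instance : Module k (OreExtension δ) := (equivPoly δ).module k

noncomputable instance : Mul (OreExtension δ) := ⟨fun p q => ⟨leftMul δ p.toPoly q.toPoly⟩⟩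

noncomputable instance : One (OreExtension δ) := ⟨⟨1⟩⟩

variable {δ}

@[simp] theorem toPoly_zero : (0 : OreExtension δ).toPoly = 0 := rfl
@[simp] theorem toPoly_one : (1 : OreExtension δ).toPoly = 1 := rfl
@[simp] theorem toPoly_add (p q : OreExtension δ) : (p + q).toPoly = p.toPoly + q.toPoly := rfl
@[simp] theorem toPoly_smul (c : k) (p : OreExtension δ) : (c • p).toPoly = c • p.toPoly := rfl
theorem toPoly_mul (p q : OreExtension δ) : (p * q).toPoly = leftMul δ p.toPoly q.toPoly := rfl

noncomputable instance : Ring (OreExtension δ) where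
  left_distrib p q r := by ext1; simp [toPoly_mul]
  right_distrib p q r := by ext1; simp [toPoly_mul]
  zero_mul p := by ext1; simp [toPoly_mul]
  mul_zero p := by ext1; simp [toPoly_mul]
  mul_assoc p q r := by ext1; simp [toPoly_mul, leftMul_leftMul]
  one_mul p := by ext1; simp [toPoly_mul, leftMul_one]
  mul_one p := by ext1; simp [toPoly_mul, leftMul_apply_one]
  neg_add_cancel := neg_add_cancel
  zsmul := (· • ·)
  zsmul_zero' := SubNegMonoid.zsmul_zero'
  zsmul_succ' := SubNegMonoid.zsmul_succ'
  zsmul_neg' := SubNegMonoid.zsmul_neg'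
  sub_eq_add_neg := sub_eq_add_neg

noncomputable instance : Algebra k (OreExtension δ) :=
  Algebra.ofModule
    (fun c p q => by
      ext1
      simp only [toPoly_mul, toPoly_smul]
      rw [← algebraMap_smul A c p.toPoly, map_smul, LinearMap.smul_apply, algebraMap_smul])
    (fun c p q => by ext1; simp [toPoly_mul])

variable (δ)

/-- The embedding of `A` in `A[z;δ]`. -/
noncomputable def C : A →+* OreExtension δ where
  toFun a := ⟨Polynomial.C a⟩
  map_one' := rfl
  map_zero' := by ext1; simp
  map_add' a b := by ext1; simp
  map_mul' a b := by
    ext1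
    change Polynomial.C (a * b) = leftMul δ (Polynomial.C a) (Polynomial.C b)
    rw [← monomial_zero_left (a := a), leftMul_monomial]
    simp [Polynomial.smul_C]

/-- The variable `z` of `A[z;δ]`. -/
noncomputable def z : OreExtension δ := ⟨Polynomial.X⟩

theorem z_mul (p : OreExtension δ) : z δ * p = ⟨mulZ δ p.toPoly⟩ := by
  ext1
  change leftMul δ Polynomial.X p.toPoly = _
  rw [← monomial_one_one_eq_X, leftMul_monomial]
  simp

/-- The defining relation of the Ore extension. -/
theorem z_mul_C (a : A) : z δ * C δ a = C δ a * z δ + C δ (δ a) := by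
  rw [z_mul]
  ext1
  change mulZ δ (Polynomial.C a) =
    leftMul δ (Polynomial.C a) Polynomial.X + Polynomial.C (δ a)
  rw [← monomial_zero_left (a := a), leftMul_monomial, mulZ_monomial]
  simp [← monomial_one_one_eq_X, smul_monomial]

/-- The stored polynomial `∑ aᵢ Xⁱ` stands for `∑ aᵢ zⁱ`. -/
theorem mk_eq_sum (p : A[X]) : (⟨p⟩ : OreExtension δ) = p.sum fun i a => C δ a * z δ ^ i := by
  have hz : ∀ n : ℕ, (z δ ^ n : OreExtension δ) = ⟨monomial n 1⟩ := by
    intro n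
    induction n with
    | zero => rfl
    | succ n ih => rw [pow_succ', ih, z_mul]; ext1; simp [mulZ_monomial]
  induction p using Polynomial.induction_on' with
  | add p q hp hq =>
    rw [Polynomial.sum_add_index p q _ (by simp) (by simp [add_mul]), ← hp, ← hq]; rfl
  | monomial n a =>
    rw [Polynomial.sum_monomial_index _ _ (by simp), hz]
    ext1
    change _ = leftMul δ (Polynomial.C a) (monomial n 1)
    rw [← monomial_zero_left (a := a), leftMul_monomial]
    simp [smul_monomial]

variable {δ}

/-- An additive subgroup stable under left multiplication by `A` and by `z` is stable under left
multiplication by all of `A[z;δ]`. -/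
theorem mul_mem_of_stable (M : AddSubgroup (OreExtension δ))
    (hC : ∀ a, ∀ x ∈ M, C δ a * x ∈ M) (hz : ∀ x ∈ M, z δ * x ∈ M)
    (r : OreExtension δ) {x : OreExtension δ} (hx : x ∈ M) : r * x ∈ M := by
  obtain ⟨p⟩ := r
  rw [mk_eq_sum, Polynomial.sum_def, Finset.sum_mul]
  refine AddSubgroup.sum_mem _ fun i hi => ?_
  clear hi
  rw [mul_assoc]
  refine hC _ _ ?_
  induction i with
  | zero => simpa using hx
  | succ n ih => rw [pow_succ', mul_assoc]; exact hz _ ih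

/-- For a `δ`-ideal `Q` of `A`, the right ideal `QR` of `R = A[z;δ]` generated by `Q`; it is also a
left ideal. -/
noncomputable def extend (Q : Ideal A) (hQ : IsDerivIdeal {δ} Q) : Ideal (OreExtension δ) where
  __ := (Submodule.span (OreExtension δ)ᵐᵒᵖ (C δ '' (Q : Set A))).toAddSubmonoid
  smul_mem' r x hx := by
    set M : Submodule (OreExtension δ)ᵐᵒᵖ (OreExtension δ) :=
      Submodule.span (OreExtension δ)ᵐᵒᵖ (C δ '' (Q : Set A)) with hM
    have hmul : ∀ y ∈ M, ∀ s : OreExtension δ, y * s ∈ M := fun y hy s =>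
      M.smul_mem (MulOpposite.op s) hy
    have hgen : ∀ q ∈ Q, C δ q ∈ M := fun q hq => Submodule.subset_span ⟨q, hq, rfl⟩
    refine mul_mem_of_stable M.toAddSubgroup ?_ ?_ r hx
    · intro a y hy
      induction hy using Submodule.span_induction with
      | mem y hy =>
        obtain ⟨q, hq, rfl⟩ := hy
        rw [← map_mul]
        exact hgen _ (Q.mul_mem_left a hq)
      | zero => rw [mul_zero]; exact M.zero_mem
      | add y w _ _ hy hw => rw [mul_add]; exact M.add_mem hy hw
      | smul s y _ hy =>
        rw [MulOpposite.smul_eq_mul_unop, ← mul_assoc]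
        exact hmul _ hy _
    · intro y hy
      induction hy using Submodule.span_induction with
      | mem y hy =>
        obtain ⟨q, hq, rfl⟩ := hy
        rw [z_mul_C]
        exact M.add_mem (hmul _ (hgen q hq) _) (hgen _ (hQ δ rfl q hq))
      | zero => rw [mul_zero]; exact M.zero_mem
      | add y w _ _ hy hw => rw [mul_add]; exact M.add_mem hy hw
      | smul s y _ hy =>
        rw [MulOpposite.smul_eq_mul_unop, ← mul_assoc]
        exact hmul _ hy _

instance (Q : Ideal A) (hQ : IsDerivIdeal {δ} Q) : (extend Q hQ).IsTwoSided where
  mul_mem_of_left {_} s hx :=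
    (Submodule.span (OreExtension δ)ᵐᵒᵖ (C δ '' (Q : Set A))).smul_mem (MulOpposite.op s) hx

end OreExtension

end Ore

/-! ### Poisson ideals of `A[X]` and `δ`-ideals of `A`. -/

section DerivationPolynomials

variable {k A : Type*} [CommRing k] [CommRing A] [Algebra k A]

/-! Elements of `R = A[z;δ]` are stored as polynomials, and `Γ` is the identity on underlying sets.
This makes sense because left multiplication by `A` and right multiplication by `z` in `R` are the
ordinary ones of `A[X]` (`leftMul_C_left`, `leftMul_X_right`), so every two-sided ideal of `R` is,
as a set, an ideal of `A[X]`.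

Both spectra turn out to be the same set of ideals `M` of `A[X]`, described by `IsCommonPrime`. If
`M` contains `J = δ(A)A`, then modulo `M` the bracket vanishes and the two products agree, so either
kind of primeness is ordinary primeness. If not, `Q = M ∩ A` is `δ`-prime and `M = Q[X]`: bracketing
with `a ∈ A`, or taking the commutator with it, lowers the degree and turns a leading coefficient
`c` in degree `n + 1` into `±(n + 1) c δ(a)`; by induction this lies in `Q` for all `a`, hence so
does `c` (`IsDerivPrime.mem_of_forall_mul_mem`, `le_map_C_of_degree_lowering`).

Conversely `Q[X]` is prime in both senses: by the same degree argument, an ideal (Poisson or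
two-sided) not inside `Q[X]` meets `A` outside `Q` once `Q[X]` is added to it, which reduces the
claim to `δ`-primeness of `Q`. The topologies match because closed sets are defined by inclusion. -/

@[simp]
theorem coeff_coeffwise (δ : Derivation k A A) (p : A[X]) (n : ℕ) :
    (coeffwise δ p).coeff n = δ (p.coeff n) := by
  induction p using Polynomial.induction_on' with
  | add p q hp hq => simp only [map_add, coeff_add, hp, hq]
  | monomial m a =>
    rw [coeffwise_monomial, coeff_monomial, coeff_monomial]
    split_ifs <;> simp

theorem coeffDerivation_apply (δ : Derivation k A A) (p : A[X]) :
    coeffDerivation δ p = coeffwise δ p := rfl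

theorem polyPoisson_apply (δ : Derivation k A A) (p q : A[X]) :
    (polyPoisson δ).ham p q = derivative p * coeffwise δ q - coeffwise δ p * derivative q := by
  simp [polyPoisson, coeffDerivation_apply]

theorem coeffwise_mem_map_C_derivRangeIdeal (δ : Derivation k A A) (p : A[X]) :
    coeffwise δ p ∈ (derivRangeIdeal δ).map (Polynomial.C : A →+* A[X]) := by
  rw [Ideal.mem_map_C_iff]
  intro n
  rw [coeff_coeffwise]
  exact Ideal.subset_span ⟨_, rfl⟩

/-- The generators of `J` are the brackets `{X, a} = δ a`; conversely each term of a bracket has a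
factor whose coefficients lie in `δ(A)`. -/
theorem polyPoisson_residuallyNull_iff (δ : Derivation k A A) (I : Ideal A[X]) :
    (polyPoisson δ).ResiduallyNull I ↔
      (derivRangeIdeal δ).map (Polynomial.C : A →+* A[X]) ≤ I := by
  constructor
  · intro h
    rw [Ideal.map_le_iff_le_comap, derivRangeIdeal, Ideal.span_le]
    rintro _ ⟨a, rfl⟩
    have := h X (Polynomial.C a)
    rw [polyPoisson_apply, ← monomial_zero_left (a := a), coeffwise_monomial] at this
    simpa using this
  · intro h p q
    rw [polyPoisson_apply]
    exact I.sub_mem (I.mul_mem_left _ (h (coeffwise_mem_map_C_derivRangeIdeal δ q)))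
      (I.mul_mem_right _ (h (coeffwise_mem_map_C_derivRangeIdeal δ p)))

theorem isDerivIdeal_polyPoisson_of_le {δ : Derivation k A A} {I : Ideal A[X]}
    (h : (derivRangeIdeal δ).map (Polynomial.C : A →+* A[X]) ≤ I) :
    IsDerivIdeal (Set.range (polyPoisson δ).ham) I := by
  rintro _ ⟨p, rfl⟩ q -
  exact (polyPoisson_residuallyNull_iff δ I).2 h p q

theorem isDerivIdeal_polyPoisson_map_C {δ : Derivation k A A} {Q : Ideal A}
    (hQ : IsDerivIdeal {δ} Q) :
    IsDerivIdeal (Set.range (polyPoisson δ).ham) (Q.map (Polynomial.C : A →+* A[X])) := by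
  rintro _ ⟨p, rfl⟩ q hq
  rw [polyPoisson_apply]
  rw [Ideal.mem_map_C_iff] at hq
  refine Ideal.sub_mem _ (Ideal.mul_mem_left _ _ ?_) (Ideal.mul_mem_left _ _ ?_) <;>
    rw [Ideal.mem_map_C_iff] <;> intro n
  · rw [coeff_coeffwise]
    exact hQ δ rfl _ (hq n)
  · rw [coeff_derivative]
    exact Q.mul_mem_right _ (hq _)

theorem isDerivIdeal_comap_C {δ : Derivation k A A} {I : Ideal A[X]}
    (hI : IsDerivIdeal (Set.range (polyPoisson δ).ham) I) :
    IsDerivIdeal {δ} (I.comap (Polynomial.C : A →+* A[X])) := by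
  rintro _ rfl a ha
  have := hI _ ⟨X, rfl⟩ _ (Ideal.mem_comap.1 ha)
  rw [polyPoisson_apply, ← monomial_zero_left (a := a), coeffwise_monomial] at this
  simpa using this

theorem IsDerivIdeal.sup {S : Type*} [CommRing S] [Algebra k S] {Δ : Set (Derivation k S S)}
    {I J : Ideal S} (hI : IsDerivIdeal Δ I) (hJ : IsDerivIdeal Δ J) : IsDerivIdeal Δ (I ⊔ J) := by
  intro d hd x hx
  obtain ⟨y, hy, z, hz, rfl⟩ := Submodule.mem_sup.1 hx
  rw [map_add]
  exact Submodule.add_mem_sup (hI d hd y hy) (hJ d hd z hz)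

/-- Allows both factors to be enlarged by `M` before primeness of `M` is tested. -/
theorem Ideal.sup_mul_sup_le {S : Type*} [CommRing S] {I I' M : Ideal S} (h : I * I' ≤ M) :
    (I ⊔ M) * (I' ⊔ M) ≤ M := by
  rw [Ideal.sup_mul, Ideal.mul_sup]
  exact sup_le (sup_le h Ideal.mul_le_right) Ideal.mul_le_left

theorem comap_C_map_C (Q : Ideal A) :
    (Q.map (Polynomial.C : A →+* A[X])).comap (Polynomial.C : A →+* A[X]) = Q := by
  ext a
  rw [Ideal.mem_comap, Ideal.mem_map_C_iff]
  refine ⟨fun h => by simpa using h 0, fun h n => ?_⟩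
  rw [coeff_C]
  split_ifs
  exacts [h, Q.zero_mem]

/-- The colon ideal `K = (Q : δ(A))` is a `δ`-ideal because `δ(x) δ(b) = δ(x δ(b)) - x δ(δ(b))`.
Since `K J ⊆ Q` and `J ⊄ Q`, `δ`-primeness gives `K ⊆ Q`. -/
theorem IsDerivPrime.mem_of_forall_mul_mem {δ : Derivation k A A} {Q : Ideal A}
    (hQ : IsDerivPrime {δ} Q) (hJ : ¬ derivRangeIdeal δ ≤ Q) {a : A}
    (ha : ∀ b, a * δ b ∈ Q) : a ∈ Q := by
  let K : Ideal A :=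
    { carrier := {x | ∀ b, x * δ b ∈ Q}
      add_mem' := fun hx hy b => by rw [add_mul]; exact Q.add_mem (hx b) (hy b)
      zero_mem' := fun b => by rw [zero_mul]; exact Q.zero_mem
      smul_mem' := fun c x hx b => by
        rw [smul_eq_mul, mul_assoc]; exact Q.mul_mem_left c (hx b) }
  have hK : IsDerivIdeal {δ} K := by
    rintro d rfl x hx b
    have h := Q.sub_mem (hQ.isDerivIdeal d rfl _ (hx b)) (hx (d b))
    rw [Derivation.leibniz, smul_eq_mul, smul_eq_mul] at h
    rwa [add_sub_cancel_left, mul_comm] at h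
  refine ((hQ.le_or_le K _ hK (isDerivIdeal_derivRangeIdeal δ) ?_).resolve_right hJ) ha
  rw [Ideal.mul_le]
  intro x hx y hy
  rw [derivRangeIdeal] at hy
  have : Ideal.span (Set.range δ) ≤ Submodule.comap (LinearMap.mulLeft A x) Q := by
    rw [Ideal.span_le]
    rintro _ ⟨b, rfl⟩
    exact hx b
  exact this hy

end DerivationPolynomials

/-! ### Classification of the Poisson primes of `A[X]`. -/

section CommonPrimes

variable {A : Type*} [CommRing A] [Algebra ℂ A] {δ : Derivation ℂ A A}

/-- An ideal of `A[X]` that meets `A` inside a `δ`-prime `Q` not containing `δ(A)` is contained in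
`Q[X]`, provided that it is stable under operations `p ↦ q` that lower the degree as the commutator
with a constant in `A[z;δ]` does. -/
theorem le_map_C_of_degree_lowering {Q : Ideal A} (hQ : IsDerivPrime {δ} Q)
    (hJ : ¬ derivRangeIdeal δ ≤ Q) {M : Ideal A[X]}
    (hQM : Q.map (Polynomial.C : A →+* A[X]) ≤ M) (hMQ : M.comap (Polynomial.C : A →+* A[X]) ≤ Q)
    (h : ∀ p ∈ M, ∀ a n, p.natDegree ≤ n + 1 → ∃ q ∈ M, q.natDegree ≤ n ∧
      q.coeff n = (n + 1 : ℕ) • (p.coeff (n + 1) * δ a)) :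
    M ≤ Q.map (Polynomial.C : A →+* A[X]) := by
  have key : ∀ n, ∀ p ∈ M, p.natDegree ≤ n → p ∈ Q.map (Polynomial.C : A →+* A[X]) := by
    intro n
    induction n with
    | zero =>
      intro p hp hn
      rw [eq_C_of_natDegree_le_zero hn] at hp ⊢
      exact Ideal.mem_map_of_mem _ (hMQ hp)
    | succ n ih =>
      intro p hp hn
      -- The lowered polynomial has degree at most `n`, so the induction hypothesis puts its
      -- coefficient `(n + 1) p_{n+1} δ(a)` in `Q` for every `a`.
      have hlead : p.coeff (n + 1) ∈ Q := by
        refine hQ.mem_of_forall_mul_mem hJ fun a => ?_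
        obtain ⟨q, hqM, hqn, hq⟩ := h p hp a n hn
        have hm := Ideal.mem_map_C_iff.1 (ih q hqM hqn) n
        rw [hq] at hm
        -- Characteristic zero enters here: `n + 1` is invertible in `ℂ`.
        have hm' := Q.mul_mem_left (algebraMap ℂ A ((n + 1 : ℕ) : ℂ)⁻¹) hm
        rw [nsmul_eq_mul, ← mul_assoc, ← map_natCast (algebraMap ℂ A), ← map_mul,
          inv_mul_cancel₀ (by exact_mod_cast n.succ_ne_zero), map_one, one_mul] at hm'
        exact hm'
      have hmon : monomial (n + 1) (p.coeff (n + 1)) ∈ Q.map (Polynomial.C : A →+* A[X]) := by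
        rw [← C_mul_X_pow_eq_monomial]
        exact Ideal.mul_mem_right _ _ (Ideal.mem_map_of_mem _ hlead)
      -- The top monomial lies in `Q[X] ⊆ M`, so removing it stays in `M` and lowers the degree.
      rw [← sub_add_cancel p (monomial (n + 1) (p.coeff (n + 1)))]
      refine Ideal.add_mem _ (ih _ (M.sub_mem hp (hQM hmon)) ?_) hmon
      rw [natDegree_le_iff_coeff_eq_zero]
      intro m hm
      rw [coeff_sub, coeff_monomial]
      split_ifs with hmn
      · rw [hmn, sub_self]
      · rw [coeff_eq_zero_of_natDegree_lt (by omega), sub_zero]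
  exact fun p hp => key _ p hp le_rfl

theorem IsDerivIdeal.le_map_C {Q : Ideal A} (hQ : IsDerivPrime {δ} Q)
    (hJ : ¬ derivRangeIdeal δ ≤ Q) {M : Ideal A[X]}
    (hM : IsDerivIdeal (Set.range (polyPoisson δ).ham) M)
    (hQM : Q.map (Polynomial.C : A →+* A[X]) ≤ M)
    (hMQ : M.comap (Polynomial.C : A →+* A[X]) ≤ Q) :
    M ≤ Q.map (Polynomial.C : A →+* A[X]) := by
  refine le_map_C_of_degree_lowering hQ hJ hQM hMQ fun p hp a n hn => ?_
  -- The witness is `-{a, p}`.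
  refine ⟨derivative p * Polynomial.C (δ a), ?_, ?_, ?_⟩
  · have := M.neg_mem (hM _ ⟨Polynomial.C a, rfl⟩ p hp)
    rw [polyPoisson_apply, ← monomial_zero_left (a := a), coeffwise_monomial] at this
    simpa [mul_comm] using this
  · exact (natDegree_mul_C_le _ _).trans ((natDegree_derivative_le p).trans (by omega))
  · rw [coeff_mul_C, coeff_derivative, nsmul_eq_mul]
    push_cast
    ring

/-- The ideals of `A[X]` whose underlying sets are the Poisson primes of `A[X]` and, at the same
time, the primes of `A[z;δ]`. -/
def IsCommonPrime (δ : Derivation ℂ A A) (M : Ideal A[X]) : Prop :=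
  ((derivRangeIdeal δ).map (Polynomial.C : A →+* A[X]) ≤ M ∧ M.IsPrime) ∨
    ∃ Q : Ideal A, IsDerivPrime {δ} Q ∧ ¬ derivRangeIdeal δ ≤ Q ∧
      M = Q.map (Polynomial.C : A →+* A[X])

theorem isDerivPrime_polyPoisson_iff {M : Ideal A[X]} :
    IsDerivPrime (Set.range (polyPoisson δ).ham) M ↔ IsCommonPrime δ M := by
  constructor
  · intro hM
    by_cases hJ : (derivRangeIdeal δ).map (Polynomial.C : A →+* A[X]) ≤ M
    · refine Or.inl ⟨hJ, Ideal.isPrime_iff.2 ⟨hM.ne_top, fun {x y} hxy => ?_⟩⟩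
      -- Principal ideals need not be Poisson; adding `M`, which contains `J`, makes them so.
      have h := hM.le_or_le (Ideal.span {x} ⊔ M) (Ideal.span {y} ⊔ M)
        (isDerivIdeal_polyPoisson_of_le (hJ.trans le_sup_right))
        (isDerivIdeal_polyPoisson_of_le (hJ.trans le_sup_right))
        (Ideal.sup_mul_sup_le (by
          rwa [Ideal.span_singleton_mul_span_singleton, Ideal.span_singleton_le_iff_mem]))
      exact h.imp
        (fun h => h (Ideal.mem_sup_left (Ideal.mem_span_singleton_self x)))
        (fun h => h (Ideal.mem_sup_left (Ideal.mem_span_singleton_self y)))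
    · right
      have hcomap : IsDerivPrime {δ} (M.comap (Polynomial.C : A →+* A[X])) := by
        refine ⟨isDerivIdeal_comap_C hM.isDerivIdeal, Ideal.comap_ne_top _ hM.ne_top, ?_⟩
        intro I I' hI hI' hII'
        rw [← Ideal.map_le_iff_le_comap] at hII' ⊢
        rw [← Ideal.map_le_iff_le_comap]
        rw [Ideal.map_mul] at hII'
        exact hM.le_or_le _ _ (isDerivIdeal_polyPoisson_map_C hI)
          (isDerivIdeal_polyPoisson_map_C hI') hII'
      rw [Ideal.map_le_iff_le_comap] at hJ
      exact ⟨_, hcomap, hJ, le_antisymm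
        (hM.isDerivIdeal.le_map_C hcomap hJ Ideal.map_comap_le le_rfl) Ideal.map_comap_le⟩
  · rintro (⟨hJ, hM⟩ | ⟨Q, hQ, hJ, rfl⟩)
    · exact ⟨isDerivIdeal_polyPoisson_of_le hJ, hM.ne_top,
        fun I I' _ _ h => hM.mul_le.1 h⟩
    · refine ⟨isDerivIdeal_polyPoisson_map_C hQ.isDerivIdeal, fun h => hQ.ne_top ?_, ?_⟩
      · rw [← comap_C_map_C Q, h, Ideal.comap_top]
      · intro I I' hI hI' h
        by_contra! hn
        have hd := isDerivIdeal_polyPoisson_map_C hQ.isDerivIdeal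
        -- Degree lowering: a Poisson ideal not inside `Q[X]` has, after adding `Q[X]`, a constant
        -- outside `Q`.
        have hmeet : ∀ K : Ideal A[X], IsDerivIdeal (Set.range (polyPoisson δ).ham) K →
            ¬ K ≤ Q.map (Polynomial.C : A →+* A[X]) →
            ¬ (K ⊔ Q.map (Polynomial.C : A →+* A[X])).comap (Polynomial.C : A →+* A[X]) ≤ Q :=
          fun K hK hn hle => hn (le_sup_left.trans
            ((hK.sup hd).le_map_C hQ hJ le_sup_right hle))
        refine (hQ.le_or_le _ _ (isDerivIdeal_comap_C (hI.sup hd))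
          (isDerivIdeal_comap_C (hI'.sup hd)) ?_).elim (hmeet I hI hn.1) (hmeet I' hI' hn.2)
        refine (Ideal.le_comap_mul _).trans ?_
        conv_rhs => rw [← comap_C_map_C Q]
        exact Ideal.comap_mono (Ideal.sup_mul_sup_le h)

end CommonPrimes

/-! ### Two-sided ideals of `A[z;δ]` as ideals of `A[X]`. -/

namespace OreExtension

section Stable

variable {k A : Type*} [CommRing k] [CommRing A] [Algebra k A] {δ : Derivation k A A}

/-- Coefficients stand to the left of `z`, so multiplying by `z` on the right only shifts exponents.
With `leftMul_C_left` this makes two-sided ideals of `A[z;δ]` closed under the product of `A[X]`. -/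
theorem leftMul_X_right (p : A[X]) : leftMul δ p X = X * p := by
  induction p using Polynomial.induction_on' with
  | add p q hp hq => simp only [map_add, LinearMap.add_apply, hp, hq, mul_add]
  | monomial n a =>
    have : (X : A[X]) = (mulZ δ ^ 1) 1 := by rw [mulZ_pow_one, monomial_one_one_eq_X]
    rw [leftMul_monomial, LinearMap.smul_apply, this, ← Module.End.mul_apply, ← pow_add,
      mulZ_pow_one, mulZ_pow_one, monomial_mul_monomial, smul_monomial, add_comm n 1]
    simp

theorem leftMul_X_left (p : A[X]) : leftMul δ X p = X * p + coeffwise δ p := by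
  rw [← monomial_one_one_eq_X, leftMul_monomial, monomial_one_one_eq_X]
  simp [mulZ]

theorem leftMul_C_left (a : A) (p : A[X]) :
    leftMul δ (Polynomial.C a) p = Polynomial.C a * p := by
  rw [← monomial_zero_left (a := a), leftMul_monomial]
  simp [Polynomial.smul_eq_C_mul]

/-- Each replacement of `mulZ` by multiplication by `X` costs one `coeffwise δ`, whose values have
coefficients in `δ(A)`. -/
theorem leftMul_sub_mul_mem (p q : A[X]) :
    leftMul δ p q - p * q ∈ (derivRangeIdeal δ).map (Polynomial.C : A →+* A[X]) := by
  have hpow : ∀ n : ℕ, (mulZ δ ^ n) q - X ^ n * q ∈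
      (derivRangeIdeal δ).map (Polynomial.C : A →+* A[X]) := by
    intro n
    induction n with
    | zero => simp
    | succ n ih =>
      have : (mulZ δ ^ (n + 1)) q - X ^ (n + 1) * q =
          X * ((mulZ δ ^ n) q - X ^ n * q) + coeffwise δ ((mulZ δ ^ n) q) := by
        rw [pow_succ', Module.End.mul_apply]
        simp only [mulZ, LinearMap.add_apply, LinearMap.mulLeft_apply]
        ring
      rw [this]
      exact Ideal.add_mem _ (Ideal.mul_mem_left _ _ ih) (coeffwise_mem_map_C_derivRangeIdeal δ _)
  induction p using Polynomial.induction_on' with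
  | add p₁ p₂ h₁ h₂ =>
    rw [map_add, LinearMap.add_apply, add_mul, add_sub_add_comm]
    exact Ideal.add_mem _ h₁ h₂
  | monomial n a =>
    rw [leftMul_monomial, LinearMap.smul_apply, ← C_mul_X_pow_eq_monomial, mul_assoc,
      Polynomial.smul_eq_C_mul, ← mul_sub]
    exact Ideal.mul_mem_left _ _ (hpow n)

/-- The product is `∑ pₙ (mulZ ^ n) q`. Taking `I = ⊤` or `Q = ⊤` gives the two halves of stability
of an extended `δ`-ideal; the general case handles products of two such ideals. -/
theorem leftMul_mem_map_C_left {Q : Ideal A} {p : A[X]}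
    (hp : p ∈ Q.map (Polynomial.C : A →+* A[X])) {I : Ideal A} {q : A[X]}
    (hq : ∀ n, (mulZ δ ^ n) q ∈ I.map (Polynomial.C : A →+* A[X])) :
    leftMul δ p q ∈ (Q * I).map (Polynomial.C : A →+* A[X]) := by
  rw [p.as_sum_support, map_sum, LinearMap.sum_apply]
  refine Ideal.sum_mem _ fun n _ => ?_
  rw [leftMul_monomial, LinearMap.smul_apply, Polynomial.smul_eq_C_mul, Ideal.map_mul]
  exact Ideal.mul_mem_mul (Ideal.mem_map_of_mem _ (Ideal.mem_map_C_iff.1 hp n)) (hq n)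

theorem mulZ_pow_mem_map_C {I : Ideal A} (hI : IsDerivIdeal {δ} I) {q : A[X]}
    (hq : q ∈ I.map (Polynomial.C : A →+* A[X])) (n : ℕ) :
    (mulZ δ ^ n) q ∈ I.map (Polynomial.C : A →+* A[X]) := by
  induction n with
  | zero => simpa using hq
  | succ n ih =>
    rw [pow_succ', Module.End.mul_apply, mulZ, LinearMap.add_apply, LinearMap.mulLeft_apply]
    refine Ideal.add_mem _ (Ideal.mul_mem_left _ _ ih) (Ideal.mem_map_C_iff.2 fun m => ?_)
    rw [coeff_coeffwise]
    exact hI δ rfl _ (Ideal.mem_map_C_iff.1 ih m)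

variable (δ) in
/-- An ideal of `A[X]` is stable if it is a two-sided ideal for the multiplication of `A[z;δ]`. -/
def IsStable (M : Ideal A[X]) : Prop :=
  ∀ p ∈ M, ∀ q, leftMul δ p q ∈ M ∧ leftMul δ q p ∈ M

theorem isStable_of_le {M : Ideal A[X]}
    (h : (derivRangeIdeal δ).map (Polynomial.C : A →+* A[X]) ≤ M) : IsStable δ M := by
  intro p hp q
  rw [← sub_add_cancel (leftMul δ p q) (p * q), ← sub_add_cancel (leftMul δ q p) (q * p)]
  exact ⟨M.add_mem (h (leftMul_sub_mul_mem p q)) (M.mul_mem_right _ hp),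
    M.add_mem (h (leftMul_sub_mul_mem q p)) (M.mul_mem_left _ hp)⟩

theorem isStable_map_C {Q : Ideal A} (hQ : IsDerivIdeal {δ} Q) :
    IsStable δ (Q.map (Polynomial.C : A →+* A[X])) := by
  intro p hp q
  constructor
  · have := leftMul_mem_map_C_left (δ := δ) hp (I := ⊤) (q := q)
      (fun n => by rw [Ideal.map_top]; trivial)
    rwa [Ideal.mul_top] at this
  · have := leftMul_mem_map_C_left (δ := δ) (Q := ⊤) (p := q) (by rw [Ideal.map_top]; trivial)
      (mulZ_pow_mem_map_C hQ hp)
    rwa [Ideal.top_mul] at this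

theorem IsStable.sup {M N : Ideal A[X]} (hM : IsStable δ M) (hN : IsStable δ N) :
    IsStable δ (M ⊔ N) := by
  intro p hp q
  obtain ⟨x, hx, y, hy, rfl⟩ := Submodule.mem_sup.1 hp
  rw [map_add, LinearMap.add_apply, map_add]
  exact ⟨Submodule.add_mem_sup (hM x hx q).1 (hN y hy q).1,
    Submodule.add_mem_sup (hM x hx q).2 (hN y hy q).2⟩

/-- `δ a` is the difference between the Ore product and the ordinary product of the variable with
`a`. -/
theorem IsStable.isDerivIdeal_comap_C {M : Ideal A[X]} (hM : IsStable δ M) :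
    IsDerivIdeal {δ} (M.comap (Polynomial.C : A →+* A[X])) := by
  rintro _ rfl a ha
  have := M.sub_mem (hM _ ha X).2 (M.mul_mem_left X ha)
  rw [leftMul_X_left, add_sub_cancel_left, ← monomial_zero_left (a := a), coeffwise_monomial] at this
  exact this

/-- The two-sided ideal of `A[z;δ]` with the same underlying set as a stable ideal of `A[X]`. -/
def toOre (M : Ideal A[X]) (hM : IsStable δ M) : Ideal (OreExtension δ) where
  carrier := {r | r.toPoly ∈ M}
  add_mem' := fun hr hs => M.add_mem hr hs
  zero_mem' := M.zero_mem
  smul_mem' := fun s _ hr => (hM _ hr s.toPoly).2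

theorem isTwoSided_toOre {M : Ideal A[X]} (hM : IsStable δ M) : (toOre M hM).IsTwoSided :=
  ⟨fun s hr => (hM _ hr s.toPoly).1⟩

/-- The ideal of `A[X]` with the same underlying set as a two-sided ideal of `A[z;δ]`. -/
def ofOre (I : Ideal (OreExtension δ)) [I.IsTwoSided] : Ideal A[X] where
  carrier := {p | (⟨p⟩ : OreExtension δ) ∈ I}
  add_mem' := fun hp hq => I.add_mem hp hq
  zero_mem' := I.zero_mem
  smul_mem' := fun s p hp => by
    have hC : ∀ (a : A) (q : A[X]), (⟨q⟩ : OreExtension δ) ∈ I →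
        (⟨Polynomial.C a * q⟩ : OreExtension δ) ∈ I := fun a q hq => by
      have := I.mul_mem_left (C δ a) hq
      rwa [show C δ a * ⟨q⟩ = ⟨Polynomial.C a * q⟩ from OreExtension.ext (leftMul_C_left a q)] at this
    have hX : ∀ q : A[X], (⟨q⟩ : OreExtension δ) ∈ I → (⟨X * q⟩ : OreExtension δ) ∈ I :=
      fun q hq => by
        have := I.mul_mem_right (z δ) hq
        rwa [show ⟨q⟩ * z δ = ⟨X * q⟩ from OreExtension.ext (leftMul_X_right q)] at this
    change (⟨s * p⟩ : OreExtension δ) ∈ I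
    induction s using Polynomial.induction_on' with
    | add s t hs ht => rw [add_mul]; exact I.add_mem hs ht
    | monomial n a =>
      rw [← C_mul_X_pow_eq_monomial, mul_assoc]
      refine hC a _ ?_
      induction n with
      | zero => simpa using hp
      | succ n ih => rw [pow_succ', mul_assoc]; exact hX _ ih

theorem isStable_ofOre (I : Ideal (OreExtension δ)) [I.IsTwoSided] : IsStable δ (ofOre I) :=
  fun _ hp q => ⟨I.mul_mem_right ⟨q⟩ hp, I.mul_mem_left ⟨q⟩ hp⟩

/-- Identifies `QR` with `Q[X]` as a set: stability of `Q[X]` absorbs right multiples, and the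
expansion `∑ aₙ zⁿ` gives the converse. -/
theorem mem_extend {Q : Ideal A} {hQ : IsDerivIdeal {δ} Q} {r : OreExtension δ} :
    r ∈ extend Q hQ ↔ r.toPoly ∈ Q.map (Polynomial.C : A →+* A[X]) := by
  constructor
  · intro hr
    have hr' : r ∈ Submodule.span (OreExtension δ)ᵐᵒᵖ (C δ '' (Q : Set A)) := hr
    induction hr' using Submodule.span_induction with
    | mem x hx =>
      obtain ⟨a, ha, rfl⟩ := hx
      exact Ideal.mem_map_of_mem _ ha
    | zero => exact Ideal.zero_mem _
    | add x y hx hy ihx ihy => exact Ideal.add_mem _ (ihx hx) (ihy hy)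
    | smul s x hx ih => exact (isStable_map_C hQ _ (ih hx) s.unop.toPoly).1
  · intro h
    obtain ⟨p⟩ := r
    rw [mk_eq_sum, Polynomial.sum_def]
    refine Ideal.sum_mem _ fun n _ => Ideal.mul_mem_right _ _ ?_
    exact Submodule.subset_span (s := C δ '' (Q : Set A)) ⟨_, Ideal.mem_map_C_iff.1 h n, rfl⟩

/-- This is `zⁿ a = ∑ (n choose m) δⁿ⁻ᵐ(a) zᵐ`, proved by Pascal's rule. -/
theorem coeff_mulZ_pow_C (a : A) (n m : ℕ) :
    ((mulZ δ ^ n) (Polynomial.C a)).coeff m = n.choose m • δ^[n - m] a := by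
  induction n generalizing m with
  | zero =>
    rcases m with _ | m
    · simp
    · simp
  | succ n ih =>
    rw [pow_succ', Module.End.mul_apply, mulZ, LinearMap.add_apply, LinearMap.mulLeft_apply,
      coeff_add, coeff_coeffwise, ← mulZ, ih, map_nsmul]
    rcases m with _ | m
    · simp [Function.iterate_succ_apply']
    · rw [coeff_X_mul, ih, Nat.choose_succ_succ, add_smul, Nat.add_sub_add_right]
      -- For `m ≥ n` the subtraction `n - (m + 1)` truncates, but its binomial coefficient is zero.
      rcases lt_or_ge m n with h | h
      · rw [← Function.iterate_succ_apply' δ, show (n - (m + 1)).succ = n - m by omega]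
      · rw [Nat.choose_eq_zero_of_lt (by omega : n < m + 1), zero_smul, zero_smul]

theorem coeff_leftMul_C {p : A[X]} {N : ℕ} (hN : p.natDegree < N) (a : A) (m : ℕ) :
    (leftMul δ p (Polynomial.C a)).coeff m =
      ∑ n ∈ Finset.range N, p.coeff n * (n.choose m • δ^[n - m] a) := by
  conv_lhs => rw [p.as_sum_range' N hN]
  rw [map_sum, LinearMap.sum_apply, finsetSum_coeff]
  refine Finset.sum_congr rfl fun n _ => ?_
  rw [leftMul_monomial, LinearMap.smul_apply, coeff_smul, coeff_mulZ_pow_C, smul_eq_mul]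

theorem natDegree_commutator_C_le {p : A[X]} {n : ℕ} (hn : p.natDegree ≤ n + 1) (a : A) :
    (leftMul δ p (Polynomial.C a) - Polynomial.C a * p).natDegree ≤ n := by
  rw [natDegree_le_iff_coeff_eq_zero]
  intro m hm
  rw [coeff_sub, coeff_leftMul_C (Nat.lt_succ_of_le hn), coeff_C_mul, sub_eq_zero,
    Finset.sum_range_succ, Finset.sum_eq_zero, zero_add]
  · rcases eq_or_lt_of_le (Nat.succ_le_of_lt hm) with rfl | h
    · simp [mul_comm]
    · rw [coeff_eq_zero_of_natDegree_lt (hn.trans_lt h), mul_zero,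
        Nat.choose_eq_zero_of_lt h, zero_smul, mul_zero]
  · intro i hi
    rw [Nat.choose_eq_zero_of_lt ((Finset.mem_range.1 hi).trans_le hm), zero_smul, mul_zero]

/-- Only degrees `n` and `n + 1` of `p` contribute: `pₙ a` cancels against `a pₙ`, leaving the
Leibniz term from `zⁿ⁺¹ a`. -/
theorem coeff_commutator_C {p : A[X]} {n : ℕ} (hn : p.natDegree ≤ n + 1) (a : A) :
    (leftMul δ p (Polynomial.C a) - Polynomial.C a * p).coeff n =
      (n + 1 : ℕ) • (p.coeff (n + 1) * δ a) := by
  rw [coeff_sub, coeff_leftMul_C (Nat.lt_succ_of_le hn), coeff_C_mul,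
    Finset.sum_range_succ, Finset.sum_range_succ, Finset.sum_eq_zero, zero_add]
  · rw [Nat.sub_self, Nat.choose_self, Nat.choose_succ_self_right, Nat.add_sub_cancel_left,
      Function.iterate_one, Function.iterate_zero, id, one_smul, mul_smul_comm]
    ring
  · intro i hi
    rw [Nat.choose_eq_zero_of_lt (Finset.mem_range.1 hi), zero_smul, mul_zero]

end Stable

/-! ### Classification of the primes of `A[z;δ]`. -/

section Primes

variable {A : Type*} [CommRing A] [Algebra ℂ A] {δ : Derivation ℂ A A}

theorem IsStable.le_map_C {Q : Ideal A} (hQ : IsDerivPrime {δ} Q)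
    (hJ : ¬ derivRangeIdeal δ ≤ Q) {M : Ideal A[X]} (hM : IsStable δ M)
    (hQM : Q.map (Polynomial.C : A →+* A[X]) ≤ M)
    (hMQ : M.comap (Polynomial.C : A →+* A[X]) ≤ Q) :
    M ≤ Q.map (Polynomial.C : A →+* A[X]) :=
  le_map_C_of_degree_lowering hQ hJ hQM hMQ fun _ hp a _ hn =>
    ⟨_, M.sub_mem (hM _ hp (Polynomial.C a)).1 (M.mul_mem_left (Polynomial.C a) hp),
      natDegree_commutator_C_le hn a, coeff_commutator_C hn a⟩

theorem _root_.IsCommonPrime.isStable {M : Ideal A[X]} (hM : IsCommonPrime δ M) :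
    IsStable δ M := by
  rcases hM with (⟨hJ, -⟩ | ⟨Q, hQ, -, rfl⟩)
  exacts [isStable_of_le hJ, isStable_map_C hQ.isDerivIdeal]

theorem isCommonPrime_ofOre (P : TwoSidedPrimeSpectrum (OreExtension δ)) :
    IsCommonPrime δ (ofOre P.asIdeal) := by
  have hS := isStable_ofOre P.asIdeal
  have hprime : ∀ N N' : Ideal A[X], IsStable δ N → IsStable δ N' →
      (∀ p ∈ N, ∀ q ∈ N', leftMul δ p q ∈ ofOre P.asIdeal) →
      N ≤ ofOre P.asIdeal ∨ N' ≤ ofOre P.asIdeal := fun N N' hN hN' h =>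
    (P.le_or_le (toOre N hN) (toOre N' hN') (isTwoSided_toOre hN) (isTwoSided_toOre hN')
      (Ideal.mul_le.2 fun r hr s hs => h _ hr _ hs)).imp
      (fun h p hp => h (show (⟨p⟩ : OreExtension δ) ∈ toOre N hN from hp))
      (fun h p hp => h (show (⟨p⟩ : OreExtension δ) ∈ toOre N' hN' from hp))
  have hne : ofOre P.asIdeal ≠ ⊤ := fun h =>
    P.ne_top ((Ideal.eq_top_iff_one _).2 ((Ideal.eq_top_iff_one (ofOre P.asIdeal)).1 h))
  by_cases hJ : (derivRangeIdeal δ).map (Polynomial.C : A →+* A[X]) ≤ ofOre P.asIdeal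
  · refine Or.inl ⟨hJ, Ideal.isPrime_iff.2 ⟨hne, fun {x y} hxy => ?_⟩⟩
    have h := hprime (Ideal.span {x} ⊔ ofOre P.asIdeal) (Ideal.span {y} ⊔ ofOre P.asIdeal)
      (isStable_of_le (hJ.trans le_sup_right)) (isStable_of_le (hJ.trans le_sup_right)) ?_
    · exact h.imp
        (fun h => h (Ideal.mem_sup_left (Ideal.mem_span_singleton_self x)))
        (fun h => h (Ideal.mem_sup_left (Ideal.mem_span_singleton_self y)))
    · intro p hp q hq
      -- Modulo `J` the Ore product is the ordinary one, where `x y ∈ M` can be used.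
      rw [← sub_add_cancel (leftMul δ p q) (p * q)]
      refine Ideal.add_mem _ (hJ (leftMul_sub_mul_mem p q))
        (Ideal.sup_mul_sup_le ?_ (Ideal.mul_mem_mul hp hq))
      rwa [Ideal.span_singleton_mul_span_singleton, Ideal.span_singleton_le_iff_mem]
  · right
    have hcomap : IsDerivPrime {δ} ((ofOre P.asIdeal).comap (Polynomial.C : A →+* A[X])) := by
      refine ⟨hS.isDerivIdeal_comap_C, Ideal.comap_ne_top _ hne, ?_⟩
      intro I I' hI hI' hII'
      rw [← Ideal.map_le_iff_le_comap] at hII' ⊢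
      rw [← Ideal.map_le_iff_le_comap]
      exact hprime _ _ (isStable_map_C hI) (isStable_map_C hI') fun p hp q hq =>
        hII' (leftMul_mem_map_C_left hp (mulZ_pow_mem_map_C hI' hq))
    rw [Ideal.map_le_iff_le_comap] at hJ
    exact ⟨_, hcomap, hJ, le_antisymm (hS.le_map_C hcomap hJ Ideal.map_comap_le le_rfl)
      Ideal.map_comap_le⟩

/-- The prime of `A[z;δ]` with the same underlying set as a common prime. -/
def primeOfCommonPrime (M : Ideal A[X]) (hM : IsCommonPrime δ M) :
    TwoSidedPrimeSpectrum (OreExtension δ) where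
  asIdeal := toOre M hM.isStable
  isTwoSided := isTwoSided_toOre _
  ne_top := by
    intro h
    have h1 : (1 : A[X]) ∈ M := (Ideal.eq_top_iff_one (toOre M hM.isStable)).1 h
    exact (isDerivPrime_polyPoisson_iff.2 hM).ne_top ((Ideal.eq_top_iff_one _).2 h1)
  le_or_le := by
    intro I I' hI hI' h
    have hle : ∀ (K : Ideal (OreExtension δ)) (_ : K.IsTwoSided), ofOre K ≤ M →
        K ≤ toOre M hM.isStable := fun K _ hK r hr => hK (show r.toPoly ∈ ofOre K from hr)
    have hmul : ∀ p ∈ ofOre I, ∀ q ∈ ofOre I', leftMul δ p q ∈ M := fun p hp q hq =>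
      h (Ideal.mul_mem_mul (show (⟨p⟩ : OreExtension δ) ∈ I from hp)
        (show (⟨q⟩ : OreExtension δ) ∈ I' from hq))
    suffices ofOre I ≤ M ∨ ofOre I' ≤ M from this.imp (hle I hI) (hle I' hI')
    have hS := hM.isStable
    obtain (⟨hJ, hP⟩ | ⟨Q, hQ, hJ, rfl⟩) := hM
    · refine hP.mul_le.1 (Ideal.mul_le.2 fun p hp q hq => ?_)
      rw [← sub_sub_cancel (leftMul δ p q) (p * q)]
      exact M.sub_mem (hmul p hp q hq) (hJ (leftMul_sub_mul_mem p q))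
    · by_contra! hn
      have hmeet : ∀ (K : Ideal (OreExtension δ)) (_ : K.IsTwoSided),
          ¬ ofOre K ≤ Q.map (Polynomial.C : A →+* A[X]) →
          ¬ (ofOre K ⊔ Q.map (Polynomial.C : A →+* A[X])).comap
            (Polynomial.C : A →+* A[X]) ≤ Q :=
        fun K _ hn hle => hn (le_sup_left.trans
          (((isStable_ofOre K).sup hS).le_map_C hQ hJ le_sup_right hle))
      refine (hQ.le_or_le _ _ ((isStable_ofOre I).sup hS).isDerivIdeal_comap_C
        ((isStable_ofOre I').sup hS).isDerivIdeal_comap_C ?_).elim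
        (hmeet I hI hn.1) (hmeet I' hI' hn.2)
      refine Ideal.mul_le.2 fun a ha b hb => ?_
      -- The hypothesis concerns Ore products, so the product of constants is read as one. In `(x +
      -- y)(u + v)`, the term `x u` is covered by `hmul`, while `x v` and `y (u + v)` lie in `Q[X]`
      -- by stability.
      rw [← comap_C_map_C Q, Ideal.mem_comap, map_mul, ← leftMul_C_left (δ := δ)]
      obtain ⟨x, hx, y, hy, hxy⟩ := Submodule.mem_sup.1 (Ideal.mem_comap.1 ha)
      obtain ⟨u, hu, v, hv, huv⟩ := Submodule.mem_sup.1 (Ideal.mem_comap.1 hb)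
      rw [← hxy, ← huv, map_add (leftMul δ), LinearMap.add_apply, map_add]
      exact Ideal.add_mem _ (Ideal.add_mem _ (hmul x hx u hu) (hS v hv x).2) (hS y hy _).1

variable (δ) in
/-- Poisson primes of `A[X]` and primes of `A[z;δ]` with the same underlying sets correspond. -/
def poissonPrimeEquiv :
    (polyPoisson δ).PrimeSpectrum ≃ TwoSidedPrimeSpectrum (OreExtension δ) where
  toFun P := primeOfCommonPrime P.asIdeal (isDerivPrime_polyPoisson_iff.1 P.isDerivPrime)
  invFun P := ⟨ofOre P.asIdeal, isDerivPrime_polyPoisson_iff.2 (isCommonPrime_ofOre P)⟩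
  left_inv _ := rfl
  right_inv _ := rfl

end Primes

end OreExtension

/-! ### Closed sets and the homeomorphism. -/

theorem DerivPrimeSpectrum.isClosed_iff {k S : Type*} [CommRing k] [CommRing S] [Algebra k S]
    {Δ : Set (Derivation k S S)} {Z : Set (DerivPrimeSpectrum Δ)} :
    IsClosed Z ↔ ∃ I : Ideal S, Z = zeroLocus Δ I :=
  isOpen_compl_iff.symm.trans (by
    change Zᶜᶜ ∈ {Z | _} ↔ _
    rw [compl_compl]
    rfl)

theorem TwoSidedPrimeSpectrum.isClosed_iff {R : Type*} [Ring R]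
    {Z : Set (TwoSidedPrimeSpectrum R)} :
    IsClosed Z ↔ ∃ I : Ideal R, I.IsTwoSided ∧ Z = zeroLocus I :=
  isOpen_compl_iff.symm.trans (by
    change Zᶜᶜ ∈ {Z | _} ↔ _
    rw [compl_compl]
    rfl)

namespace OreExtension

section Homeomorphism

variable {A : Type*} [CommRing A] [Algebra ℂ A] (δ : Derivation ℂ A A)

/-- The bijection between Poisson primes and primes with the same underlying sets is a
homeomorphism. -/
def poissonPrimeHomeomorph :
    (polyPoisson δ).PrimeSpectrum ≃ₜ TwoSidedPrimeSpectrum (OreExtension δ) where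
  toEquiv := poissonPrimeEquiv δ
  continuous_toFun := by
    rw [continuous_iff_isClosed]
    intro Z hZ
    obtain ⟨I, hI, rfl⟩ := TwoSidedPrimeSpectrum.isClosed_iff.1 hZ
    refine DerivPrimeSpectrum.isClosed_iff.2 ⟨ofOre I, ?_⟩
    ext P
    exact ⟨fun h p hp => h (show (⟨p⟩ : OreExtension δ) ∈ I from hp),
      fun h r hr => h (show r.toPoly ∈ ofOre I from hr)⟩
  continuous_invFun := by
    rw [continuous_iff_isClosed]
    intro Z hZ
    obtain ⟨I, rfl⟩ := DerivPrimeSpectrum.isClosed_iff.1 hZ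
    -- The set `I` need not be a two-sided ideal of `A[z;δ]`; the one it generates lies in the same
    -- primes.
    let T : TwoSidedIdeal (OreExtension δ) := TwoSidedIdeal.span (toPoly ⁻¹' (I : Set A[X]))
    refine TwoSidedPrimeSpectrum.isClosed_iff.2
      ⟨TwoSidedIdeal.asIdeal T, inferInstance, ?_⟩
    ext P
    constructor
    · intro h r hr
      have hr' : r ∈ T := hr
      have := TwoSidedIdeal.mem_span_iff.1 hr' (Ideal.toTwoSided P.asIdeal)
        (fun s hs => Ideal.mem_toTwoSided.2 (h hs))
      exact Ideal.mem_toTwoSided.1 this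
    · intro h p hp
      exact h (show (⟨p⟩ : OreExtension δ) ∈ T from TwoSidedIdeal.subset_span hp)

@[simp]
theorem mem_poissonPrimeHomeomorph {P : (polyPoisson δ).PrimeSpectrum} {r : OreExtension δ} :
    r ∈ (poissonPrimeHomeomorph δ P).asIdeal ↔ r.toPoly ∈ P.asIdeal := Iff.rfl

end Homeomorphism

/-! ### Commutative quotients and the isomorphism modulo `J`. -/

section Quotient

variable {k A : Type*} [CommRing k] [CommRing A] [Algebra k A] (δ : Derivation k A A)

/-- `δ a` is the commutator of `z` and `a`; conversely every commutator is a difference of two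
deviations from the ordinary product, both in the ideal generated by `J`. -/
theorem commute_quotient_iff {I : Ideal (OreExtension δ)} [I.IsTwoSided] :
    (∀ x y : OreExtension δ ⧸ I, x * y = y * x) ↔ derivRangeIdeal δ ≤
      (ofOre I).comap (Polynomial.C : A →+* A[X]) := by
  constructor
  · intro h
    rw [derivRangeIdeal, Ideal.span_le]
    rintro _ ⟨a, rfl⟩
    have := h (Ideal.Quotient.mk I (z δ)) (Ideal.Quotient.mk I (C δ a))
    rwa [← map_mul, ← map_mul, Ideal.Quotient.eq, z_mul_C, add_sub_cancel_left] at this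
  · intro h x y
    obtain ⟨r, rfl⟩ := Ideal.Quotient.mk_surjective x
    obtain ⟨s, rfl⟩ := Ideal.Quotient.mk_surjective y
    rw [← map_mul, ← map_mul, Ideal.Quotient.eq]
    rw [← Ideal.map_le_iff_le_comap] at h
    have := (ofOre I).sub_mem (h (leftMul_sub_mul_mem r.toPoly s.toPoly))
      (h (leftMul_sub_mul_mem s.toPoly r.toPoly))
    rwa [mul_comm s.toPoly, sub_sub_sub_cancel_right] at this

/-- The algebra homomorphism from `A[X]` onto `A[z;δ]` modulo the ideal generated by `δ(A)`. -/
noncomputable def polyToQuotient :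
    A[X] →ₐ[k] (OreExtension δ ⧸ extend (derivRangeIdeal δ) (isDerivIdeal_derivRangeIdeal δ)) :=
  AlgHom.ofLinearMap
    { toFun := fun p => Ideal.Quotient.mk _ ⟨p⟩
      map_add' := fun _ _ => rfl
      map_smul' := fun _ _ => rfl }
    rfl
    (fun p q => by
      change Ideal.Quotient.mk _ _ = Ideal.Quotient.mk _ _ * Ideal.Quotient.mk _ _
      rw [← map_mul, eq_comm, Ideal.Quotient.eq, mem_extend]
      exact leftMul_sub_mul_mem p q)

@[simp]
theorem polyToQuotient_apply (p : A[X]) :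
    polyToQuotient δ p = Ideal.Quotient.mk _ (⟨p⟩ : OreExtension δ) := rfl

theorem polyToQuotient_eq_zero_iff (p : A[X]) :
    polyToQuotient δ p = 0 ↔ p ∈ (derivRangeIdeal δ).map (Polynomial.C : A →+* A[X]) := by
  rw [polyToQuotient_apply, Ideal.Quotient.eq_zero_iff_mem, mem_extend]

/-- Modulo the ideals generated by `δ(A)`, the algebras `A[X]` and `A[z;δ]` are isomorphic. -/
noncomputable def quotientEquiv :
    (A[X] ⧸ (derivRangeIdeal δ).map (Polynomial.C : A →+* A[X])) ≃ₐ[k]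
      (OreExtension δ ⧸ extend (derivRangeIdeal δ) (isDerivIdeal_derivRangeIdeal δ)) :=
  AlgEquiv.ofBijective
    (Ideal.Quotient.liftₐ _ (polyToQuotient δ) fun p hp => (polyToQuotient_eq_zero_iff δ p).2 hp)
    ⟨by
      rw [injective_iff_map_eq_zero]
      intro x hx
      obtain ⟨p, rfl⟩ := Ideal.Quotient.mk_surjective x
      exact Ideal.Quotient.eq_zero_iff_mem.2 ((polyToQuotient_eq_zero_iff δ p).1 hx),
    fun y => by
      obtain ⟨r, rfl⟩ := Ideal.Quotient.mk_surjective y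
      exact ⟨Ideal.Quotient.mk _ r.toPoly, rfl⟩⟩

end Quotient

end OreExtension

theorem theorem3 {A : Type*} [CommRing A] [IsDomain A] [IsNoetherianRing A] [Algebra ℂ A]
    (δ : Derivation ℂ A A) (hδ : δ ≠ 0) :
    ∃ Γ : (polyPoisson δ).PrimeSpectrum ≃ₜ TwoSidedPrimeSpectrum (OreExtension δ),
      (∀ P : (polyPoisson δ).PrimeSpectrum,
        (polyPoisson δ).ResiduallyNull P.asIdeal ↔
          ∀ x y : OreExtension δ ⧸ (Γ P).asIdeal, x * y = y * x) ∧
      (∃ κ : (A[X] ⧸ (derivRangeIdeal δ).map (Polynomial.C : A →+* A[X])) ≃ₐ[ℂ]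
          (OreExtension δ ⧸ OreExtension.extend (derivRangeIdeal δ)
            (isDerivIdeal_derivRangeIdeal δ)),
        (∀ p : A[X], κ (Ideal.Quotient.mk _ p) = Ideal.Quotient.mk _
          (p.sum fun i a => OreExtension.C δ a * OreExtension.z δ ^ i)) ∧
        ∀ P : (polyPoisson δ).PrimeSpectrum, (polyPoisson δ).ResiduallyNull P.asIdeal →
          (Γ P).asIdeal.map (Ideal.Quotient.mk (OreExtension.extend (derivRangeIdeal δ)
            (isDerivIdeal_derivRangeIdeal δ))) =
          (P.asIdeal.map (Ideal.Quotient.mk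
            ((derivRangeIdeal δ).map (Polynomial.C : A →+* A[X])))).map κ) ∧
      ∀ P : (polyPoisson δ).PrimeSpectrum, ¬ (polyPoisson δ).ResiduallyNull P.asIdeal →
        ∃ (Q : Ideal A) (hQ : IsDerivPrime {δ} Q), ¬ derivRangeIdeal δ ≤ Q ∧
          P.asIdeal = Q.map (Polynomial.C : A →+* A[X]) ∧
          (Γ P).asIdeal = OreExtension.extend Q hQ.isDerivIdeal := by 
  refine ⟨OreExtension.poissonPrimeHomeomorph δ, fun P => ?_,
    ⟨OreExtension.quotientEquiv δ, fun p => ?_, fun P _ => ?_⟩, fun P hP => ?_⟩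
  · rw [polyPoisson_residuallyNull_iff, Ideal.map_le_iff_le_comap,
      OreExtension.commute_quotient_iff]
    rfl
  · rw [← OreExtension.mk_eq_sum]
    rfl
  -- `Γ` keeps underlying sets and `κ` sends the class of `p` to that of `⟨p⟩`, so both inclusions
  -- hold element by element.
  · apply le_antisymm
    · rw [Ideal.map_le_iff_le_comap]
      intro r hr
      have := Ideal.mem_map_of_mem (OreExtension.quotientEquiv δ) (Ideal.mem_map_of_mem
        (Ideal.Quotient.mk ((derivRangeIdeal δ).map (Polynomial.C : A →+* A[X])))
        ((OreExtension.mem_poissonPrimeHomeomorph δ).1 hr))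
      exact this
    · rw [Ideal.map_le_iff_le_comap, Ideal.map_le_iff_le_comap]
      intro p hp
      exact Ideal.mem_map_of_mem (Ideal.Quotient.mk (OreExtension.extend (derivRangeIdeal δ)
        (isDerivIdeal_derivRangeIdeal δ)))
        ((OreExtension.mem_poissonPrimeHomeomorph δ (r := ⟨p⟩)).2 hp)
  · rw [polyPoisson_residuallyNull_iff] at hP
    obtain ⟨Q, hQ, hJ, hPQ⟩ :=
      (isDerivPrime_polyPoisson_iff.1 P.isDerivPrime).resolve_left fun h => hP h.1
    refine ⟨Q, hQ, hJ, hPQ, ?_⟩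
    ext r
    rw [OreExtension.mem_poissonPrimeHomeomorph, OreExtension.mem_extend, hPQ]
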